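/- Let $m\in\mathcal C^1([-1,1];\mathbb R)$ and suppose that there is a unique $x_0\in(-1,1)$ with $m(x_0)=\max_{[-1,1]}m$, that $m'\ge 0$ on $[-1,x_0)$, that $m'\le 0$ on $(x_0,1]$, and that $m$ has at most finitely many critical points in $(-1,1)$. Let $c\in\mathcal C([-1,1];\mathbb R)$ satisfy one of the following conditions (where increasing and decreasing are meant in the non-strict sense): (a) there is $y_0\in(-1,1)$ such that $c$ is increasing on $[-1,y_0)$ and decreasing on $(y_0,1]$; (b) there is $y_0\in(-1,1)$ such that $c$ is decreasing on $[-1,y_0)$ and increasing on $(y_0,1]$; (c) $c$ is increasing on $[-1,1]$; (d) $c$ is decreasing on $[-1,1]$. For $s\in\mathbb R$ consider the eigenvalue problem $$-\varphi''-2s\,m'(x)\varphi'+c(x)\varphi=\lambda\varphi\quad\text{in }[-1,1],\qquad \varphi'(-1)=\varphi'(1)=0 .$$ Then for every $s\in\mathbb R$ there is exactly one $\lambda=\lambda(s)\in\mathbb R$, the principal eigenvalue, for which this problem has a solution $\varphi\in\mathcal C^2([-1,1])$ with $\varphi>0$ on $[-1,1]$, and $$\lim_{s\to\infty}\lambda(s)=c(x_0).$$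 -/

import Mathlib

open Set Filter Topology

/-- The compact interval `[-1,1]`; derivatives at `-1` and `1` are one-sided. -/
abbrev unitIcc : Set ℝ := Icc (-1) 1

/-- The advection potential `m` is of class `C¹` on `[-1,1]`, `x₀ ∈ (-1,1)` is the only point of
`(-1,1)` at which `m` attains its maximum over `[-1,1]`, `m' ≥ 0` to the left of `x₀`, `m' ≤ 0` to
the right of `x₀`, and `m` has at most finitely many critical points in `(-1,1)`. -/
structure AdmissiblePotential (m : ℝ → ℝ) (x₀ : ℝ) : Prop where
  contDiffOn : ContDiffOn ℝ 1 m unitIcc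
  mem : x₀ ∈ Ioo (-1 : ℝ) 1
  isMaxOn : IsMaxOn m unitIcc x₀
  unique : ∀ y ∈ Ioo (-1 : ℝ) 1, IsMaxOn m unitIcc y → y = x₀
  deriv_nonneg : ∀ x ∈ Ico (-1) x₀, 0 ≤ derivWithin m unitIcc x
  deriv_nonpos : ∀ x ∈ Ioc x₀ 1, derivWithin m unitIcc x ≤ 0
  finite_critical : {x ∈ Ioo (-1 : ℝ) 1 | derivWithin m unitIcc x = 0}.Finite

/-- `c` is increasing, or decreasing, or increasing and then decreasing, or decreasing and then
increasing, on `[-1,1]` (all in the non-strict sense). -/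
def MonotoneOrUnimodal (c : ℝ → ℝ) : Prop :=
  (∃ y₀ ∈ Ioo (-1 : ℝ) 1, MonotoneOn c (Ico (-1) y₀) ∧ AntitoneOn c (Ioc y₀ 1)) ∨
  (∃ y₀ ∈ Ioo (-1 : ℝ) 1, AntitoneOn c (Ico (-1) y₀) ∧ MonotoneOn c (Ioc y₀ 1)) ∨
  MonotoneOn c unitIcc ∨
  AntitoneOn c unitIcc

/-- `φ` is a classical (`C²`) solution on `[-1,1]` of the Neumann problem
`-φ'' - 2 s m' φ' + c φ = l φ`, `φ'(-1) = φ'(1) = 0`. -/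
structure IsNeumannSolution (m c : ℝ → ℝ) (s l : ℝ) (φ : ℝ → ℝ) : Prop where
  contDiffOn : ContDiffOn ℝ 2 φ unitIcc
  equation : ∀ x ∈ unitIcc,
    -iteratedDerivWithin 2 φ unitIcc x
      - 2 * s * derivWithin m unitIcc x * derivWithin φ unitIcc x + c x * φ x = l * φ x
  neumann_left : derivWithin φ unitIcc (-1) = 0
  neumann_right : derivWithin φ unitIcc 1 = 0

/-- `l` is a principal eigenvalue of the Neumann problem: it is a real eigenvalue with an
eigenfunction that is positive on `[-1,1]`. -/
def IsPrincipalEigenvalue (m c : ℝ → ℝ) (s l : ℝ) : Prop :=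
  ∃ φ : ℝ → ℝ, IsNeumannSolution m c s l φ ∧ ∀ x ∈ unitIcc, 0 < φ x

/-! Write `W = exp (2 s m)`; the equation becomes `(W φ')' = W (c - l) φ`. Existence: `P = W φ' / φ`
turns it into the Riccati problem `P' = W (c - l) - P² / W`, `P (-1) = P 1 = 0`, solved by shooting
in `l` (`exists_riccati_solution`); `φ` is recovered from its logarithmic derivative. Uniqueness and
all bounds on `l` come from one device, `exists_eq_mul`: if `(W ψ')' = W b` with Neumann conditions,
Rolle applied to `W (φ ψ' - φ' ψ)` gives a point where `b = (c - l) ψ`. Limit: let `μ` be the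
`W`-weighted mean of `c`. Since `W (c - μ)` has integral zero, some `ψ = 1 + η` satisfies Neumann
conditions and `(W ψ')' = W (c - μ)`. At the Rolle point `l - μ = (c - l) η`, so `|l - μ| ≤ 2 B sup
|η|`. As `s → ∞`, `μ → c x₀` by Laplace concentration (`tendsto_weightedMean`), while `η → 0`
uniformly because `m` is strictly monotone on each side of `x₀`
(`tendsto_integral_abs_weightedPrimitive_div`). -/

/-! ### The Riccati boundary value problem by shooting. -/

/-- Truncation of a real number to `[-M, M]`. -/
noncomputable def clamp (M p : ℝ) : ℝ := max (-M) (min M p)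

lemma abs_clamp_le {M : ℝ} (hM : 0 ≤ M) (p : ℝ) : |clamp M p| ≤ M :=
  abs_le.2 ⟨le_max_left _ _, max_le (by linarith) (min_le_left _ _)⟩

lemma clamp_of_abs_le {M p : ℝ} (hp : |p| ≤ M) : clamp M p = p := by
  obtain ⟨h1, h2⟩ := abs_le.1 hp
  simp [clamp, h1, h2]

lemma abs_clamp_sub_clamp_le (M p q : ℝ) : |clamp M p - clamp M q| ≤ |p - q| := by
  unfold clamp
  refine (abs_max_sub_max_le_max _ _ _ _).trans (max_le (by simp) ?_)
  exact (abs_min_sub_min_le_max _ _ _ _).trans (by simp)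

/-- The right-hand side of the Riccati equation with the quadratic term truncated. -/
noncomputable def truncatedRiccati (W c : ℝ → ℝ) (M l t p : ℝ) : ℝ :=
  W t * (c t - l) - clamp M p ^ 2 / W t

lemma lipschitzWith_truncatedRiccati {W : ℝ → ℝ} {a M : ℝ} (c : ℝ → ℝ) (ha : 0 < a)
    (haW : ∀ x, a ≤ W x) (hM : 0 ≤ M) (l t : ℝ) :
    LipschitzWith (2 * M / a).toNNReal (truncatedRiccati W c M l t) := by
  refine LipschitzWith.of_dist_le_mul fun p q ↦ ?_
  rw [Real.coe_toNNReal _ (by positivity), Real.dist_eq, Real.dist_eq]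
  have hW : 0 < W t := ha.trans_le (haW t)
  have e : truncatedRiccati W c M l t p - truncatedRiccati W c M l t q =
      (clamp M p + clamp M q) / W t * (clamp M q - clamp M p) := by
    unfold truncatedRiccati; ring
  rw [e, abs_mul, abs_div, abs_of_pos hW]
  have h1 : |clamp M p + clamp M q| ≤ 2 * M :=
    (abs_add_le _ _).trans (by linarith [abs_clamp_le hM p, abs_clamp_le hM q])
  have h2 : |clamp M q - clamp M p| ≤ |p - q| := by
    rw [abs_sub_comm]; exact abs_clamp_sub_clamp_le M p q
  have := haW t
  gcongr

/-- Truncation makes the field bounded and globally Lipschitz in `p`, which excludes blow-up before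
`1`. -/
lemma exists_truncatedRiccati_solution {W c : ℝ → ℝ} {a b B M : ℝ} (hW : Continuous W)
    (hc : Continuous c) (ha : 0 < a) (haW : ∀ x, a ≤ W x) (hWb : ∀ x, W x ≤ b)
    (hcB : ∀ x, |c x| ≤ B) (hM : 0 ≤ M) (l : ℝ) :
    ∃ P : ℝ → ℝ, P (-1) = 0 ∧ ∀ x ∈ Icc (-1 : ℝ) 1,
      HasDerivWithinAt P (truncatedRiccati W c M l x (P x)) (Icc (-1) 1) x := by
  have hb : 0 < b := ha.trans_le ((haW 0).trans (hWb 0))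
  have hB : 0 ≤ B := (abs_nonneg _).trans (hcB 0)
  -- A bound for the field; over a time interval of length 2 the solution stays within `L * 2` of
  -- its initial value.
  set L : ℝ := b * (B + |l|) + M ^ 2 / a with hL
  have hL0 : 0 ≤ L := by positivity
  have hp : IsPicardLindelof (truncatedRiccati W c M l) (tmin := -1) (tmax := 1)
      ⟨-1, by norm_num⟩ 0 (L * 2).toNNReal 0 L.toNNReal (2 * M / a).toNNReal := by
    refine ⟨fun t _ ↦ (lipschitzWith_truncatedRiccati c ha haW hM l t).lipschitzOnWith,
      fun p _ ↦ ?_, fun t _ p _ ↦ ?_, ?_⟩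
    · unfold truncatedRiccati
      exact ((hW.mul (hc.sub continuous_const)).sub
        (continuous_const.div hW fun x ↦ (ha.trans_le (haW x)).ne')).continuousOn
    · rw [Real.coe_toNNReal _ hL0, Real.norm_eq_abs]
      have hWt : 0 < W t := ha.trans_le (haW t)
      unfold truncatedRiccati
      refine (abs_sub _ _).trans ?_
      rw [abs_mul, abs_div, abs_pow, abs_of_pos hWt]
      have h1 : |c t - l| ≤ B + |l| := (abs_sub _ _).trans (by linarith [hcB t])
      have h2 := abs_clamp_le hM p
      have h3 := hWb t
      have h4 := haW t
      rw [hL]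
      gcongr
    · rw [Real.coe_toNNReal _ hL0, Real.coe_toNNReal _ (by positivity)]
      norm_num
  obtain ⟨P, h0, h1⟩ := hp.exists_eq_forall_mem_Icc_hasDerivWithinAt₀
  exact ⟨P, h0, h1⟩

/-- Solvability of the Riccati boundary value problem `P' = W (c - l) - P² / W`,
`P (-1) = P 1 = 0`, for a suitable `l`. -/
lemma exists_riccati_solution {W c : ℝ → ℝ} {a b B : ℝ} (hW : Continuous W)
    (hc : Continuous c) (ha : 0 < a) (haW : ∀ x, a ≤ W x) (hWb : ∀ x, W x ≤ b)
    (hcB : ∀ x, |c x| ≤ B) :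
    ∃ (l : ℝ) (P : ℝ → ℝ), P (-1) = 0 ∧ P 1 = 0 ∧ ∀ x ∈ Icc (-1 : ℝ) 1,
      HasDerivWithinAt P (W x * (c x - l) - P x ^ 2 / W x) (Icc (-1) 1) x := by
  have hb : 0 < b := ha.trans_le ((haW 0).trans (hWb 0))
  have hB : 0 ≤ B := (abs_nonneg _).trans (hcB 0)
  have hW0 : ∀ x, 0 < W x := fun x ↦ ha.trans_le (haW x)
  -- `D` bounds `W (c - l)` from above for every `l ≥ -B - 1`, the range used for shooting; the
  -- truncation level is `D` times the interval length.
  set D : ℝ := b * (2 * B + 1) with hD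
  have hD0 : 0 ≤ D := by positivity
  have hM : 0 ≤ 2 * D := by positivity
  choose P hP0 hP using fun l ↦ exists_truncatedRiccati_solution hW hc ha haW hWb hcB hM l
  have hPc : ∀ l, ContinuousOn (P l) (Icc (-1) 1) := fun l x hx ↦ (hP l x hx).continuousWithinAt
  have hPr : ∀ l, ∀ x ∈ Ico (-1 : ℝ) 1,
      HasDerivWithinAt (P l) (truncatedRiccati W c (2 * D) l x (P l x)) (Ici x) x := fun l x hx ↦
    (hP l x (Ico_subset_Icc_self hx)).mono_of_mem_nhdsWithin (Icc_mem_nhdsGE_of_mem hx)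
  have hPi : ∀ l, ∀ x ∈ Ioo (-1 : ℝ) 1,
      HasDerivAt (P l) (truncatedRiccati W c (2 * D) l x (P l x)) x := fun l x hx ↦
    (hP l x (Ioo_subset_Icc_self hx)).hasDerivAt (Icc_mem_nhds hx.1 hx.2)
  -- Grönwall: changing `l` to `k` perturbs the field by at most `b * |k - l|`.
  have hcont : Continuous fun l ↦ P l 1 := by
    rw [continuous_iff_continuousAt]
    intro l
    have hle : ∀ k, dist (P k 1) (P l 1) ≤
        gronwallBound 0 (2 * (2 * D) / a).toNNReal (b * |k - l| + 0) (1 - -1) := by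
      intro k
      refine dist_le_of_approx_trajectories_ODE (v := truncatedRiccati W c (2 * D) l)
        (fun t ↦ lipschitzWith_truncatedRiccati c ha haW hM l t) (hPc k) (hPr k) ?_ (hPc l) (hPr l)
        (fun t _ ↦ (dist_self _).le) (by simp [hP0]) 1 (by norm_num)
      intro t _
      have e : truncatedRiccati W c (2 * D) k t (P k t) - truncatedRiccati W c (2 * D) l t (P k t) =
          - (W t * (k - l)) := by unfold truncatedRiccati; ring
      rw [Real.dist_eq, e, abs_neg, abs_mul, abs_of_pos (hW0 t)]
      exact mul_le_mul_of_nonneg_right (hWb t) (abs_nonneg _)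
    rw [ContinuousAt, tendsto_iff_dist_tendsto_zero]
    refine squeeze_zero (fun _ ↦ dist_nonneg) hle ?_
    have hg := (gronwallBound_continuous_ε 0 (2 * (2 * D) / a).toNNReal (1 - -1)).comp
      (by fun_prop : Continuous fun k : ℝ ↦ b * |k - l| + 0)
    simpa [Function.comp_def, gronwallBound_ε0_δ0] using hg.tendsto l
  -- The quadratic term only pushes `P` down, so dropping it leaves an upper bound for the slope.
  have hle : ∀ l E, (∀ x, W x * (c x - l) ≤ E) → ∀ u ∈ Icc (-1 : ℝ) 1, ∀ v ∈ Icc (-1 : ℝ) 1,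
      u ≤ v → P l v - P l u ≤ E * (v - u) := by
    intro l E hE
    refine (convex_Icc (-1 : ℝ) 1).image_sub_le_mul_sub_of_deriv_le (hPc l) ?_ ?_
    all_goals
      rw [interior_Icc]
      intro y hy
    · exact (hPi l y hy).differentiableAt.differentiableWithinAt
    · rw [(hPi l y hy).deriv, truncatedRiccati]
      have := div_nonneg (sq_nonneg (clamp (2 * D) (P l y))) (hW0 y).le
      linarith [hE y]
  have h1 : P B 1 ≤ 0 := by
    have := hle B 0 (fun x ↦ mul_nonpos_of_nonneg_of_nonpos (hW0 x).le
      (by linarith [(abs_le.1 (hcB x)).2])) (-1) (by norm_num) 1 (by norm_num) (by norm_num)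
    simpa [hP0] using this
  -- For `l = -B - 1` the slope at any zero of `P` is `W (c - l) > 0`, so `P` cannot become
  -- negative.
  have h2 : 0 ≤ P (-B - 1) 1 := by
    have := image_le_of_deriv_right_lt_deriv_boundary' (f := fun x ↦ - P (-B - 1) x)
      (hPc _).neg (fun x hx ↦ (hPr _ x hx).neg) (B := fun _ ↦ 0) (B' := fun _ ↦ 0)
      (by simp [hP0]) continuousOn_const (fun x hx ↦ hasDerivWithinAt_const _ _ _) ?_
      (right_mem_Icc.2 (by norm_num : (-1 : ℝ) ≤ 1))
    · simpa using this
    · intro x hx h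
      have h : P (-B - 1) x = 0 := by simpa using h
      have h3 := (abs_le.1 (hcB x)).1
      have := mul_pos (hW0 x) (by linarith : 0 < c x - (-B - 1))
      rw [h, truncatedRiccati, clamp_of_abs_le (by simpa using hD0)]
      simpa using this
  obtain ⟨l, hl, hl1⟩ := intermediate_value_Icc' (by linarith : -B - 1 ≤ B)
    hcont.continuousOn ⟨h1, h2⟩
  refine ⟨l, P l, hP0 l, hl1, fun x hx ↦ ?_⟩
  have key := hle l D fun x ↦ by
    have h3 := (abs_le.1 (hcB x)).2
    have h4 := hl.1
    calc W x * (c x - l) ≤ W x * (2 * B + 1) :=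
          mul_le_mul_of_nonneg_left (by linarith) (hW0 x).le
      _ ≤ b * (2 * B + 1) := mul_le_mul_of_nonneg_right (hWb x) (by linarith)
  have hx1 := key (-1) (by norm_num) x hx hx.1
  have hx2 := key x hx 1 (by norm_num) hx.2
  rw [hP0] at hx1
  simp only [hl1] at hx2
  -- Slope at most `D` bounds `P` above starting from `P (-1) = 0`, and below because `P` must climb
  -- back to `P 1 = 0`. Hence the truncation is inactive.
  have : |P l x| ≤ 2 * D := abs_le.2 ⟨by nlinarith [hx.1, hx.2], by nlinarith [hx.1, hx.2]⟩
  have h := hP l x hx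
  rwa [truncatedRiccati, clamp_of_abs_le this] at h

/-! ### Positive solutions compared through the Wronskian. -/

lemma exists_bounded_continuous_extension {f : ℝ → ℝ} (hf : ContinuousOn f unitIcc) :
    ∃ g : ℝ → ℝ, Continuous g ∧ EqOn g f unitIcc ∧ ∃ B, ∀ x, |g x| ≤ B := by
  have h : (-1 : ℝ) ≤ 1 := by norm_num
  obtain ⟨B, hB⟩ := isCompact_Icc.exists_bound_of_continuousOn hf
  refine ⟨IccExtend h (unitIcc.domRestrict f), hf.domRestrict.Icc_extend', fun x hx ↦ ?_, B,
    fun x ↦ hB _ (projIcc (-1) 1 h x).2⟩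
  rw [IccExtend_of_mem h _ hx, domRestrict_apply]

lemma hasDerivAt_of_derivWithin {f : ℝ → ℝ} (hf : DifferentiableOn ℝ f unitIcc) {x : ℝ}
    (hx : x ∈ Ioo (-1 : ℝ) 1) : HasDerivAt f (derivWithin f unitIcc x) x :=
  (hf x (Ioo_subset_Icc_self hx)).hasDerivWithinAt.hasDerivAt (Icc_mem_nhds hx.1 hx.2)

namespace IsNeumannSolution

variable {m c φ : ℝ → ℝ} {s l : ℝ}

lemma hasDerivAt (h : IsNeumannSolution m c s l φ) {x : ℝ} (hx : x ∈ Ioo (-1 : ℝ) 1) :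
    HasDerivAt φ (derivWithin φ unitIcc x) x :=
  hasDerivAt_of_derivWithin (h.contDiffOn.differentiableOn (by norm_num)) hx

lemma contDiffOn_derivWithin (h : IsNeumannSolution m c s l φ) :
    ContDiffOn ℝ 1 (derivWithin φ unitIcc) unitIcc :=
  h.contDiffOn.derivWithin (uniqueDiffOn_Icc (by norm_num)) (by norm_num)

/-- The equation in divergence form. -/
lemma hasDerivAt_flux (hm : ContDiffOn ℝ 1 m unitIcc) (h : IsNeumannSolution m c s l φ) {x : ℝ}
    (hx : x ∈ Ioo (-1 : ℝ) 1) :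
    HasDerivAt (fun y ↦ Real.exp (2 * s * m y) * derivWithin φ unitIcc y)
      (Real.exp (2 * s * m x) * ((c x - l) * φ x)) x := by
  have h1 := hasDerivAt_of_derivWithin (hm.differentiableOn (by norm_num)) hx
  have h2 := hasDerivAt_of_derivWithin (h.contDiffOn_derivWithin.differentiableOn (by norm_num)) hx
  have h3 := h.equation x (Ioo_subset_Icc_self hx)
  have h4 : iteratedDerivWithin 2 φ unitIcc x =
      derivWithin (derivWithin φ unitIcc) unitIcc x := by
    rw [iteratedDerivWithin_succ', iteratedDerivWithin_one]
  rw [h4] at h3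
  refine ((h1.const_mul (2 * s)).exp.mul h2).congr_deriv ?_
  linear_combination (-Real.exp (2 * s * m x)) * h3

/-- A Rolle-type comparison of a positive solution with a function `ψ` satisfying Neumann
boundary conditions. -/
lemma exists_eq_mul (hm : ContDiffOn ℝ 1 m unitIcc) (h : IsNeumannSolution m c s l φ)
    (hφ : ∀ x ∈ unitIcc, 0 < φ x) {ψ Q b : ℝ → ℝ} (hψ : ContinuousOn ψ unitIcc)
    (hQ : ContinuousOn Q unitIcc) (hQ0 : Q (-1) = 0) (hQ1 : Q 1 = 0)
    (hψ' : ∀ x ∈ Ioo (-1 : ℝ) 1, HasDerivAt ψ (Q x / Real.exp (2 * s * m x)) x)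
    (hQ' : ∀ x ∈ Ioo (-1 : ℝ) 1, HasDerivAt Q (Real.exp (2 * s * m x) * b x) x) :
    ∃ ξ ∈ Ioo (-1 : ℝ) 1, b ξ = (c ξ - l) * ψ ξ := by
  have hmc := hm.continuousOn
  have hdc := h.contDiffOn_derivWithin.continuousOn
  have hφc := h.contDiffOn.continuousOn
  -- Here `Q = W ψ'`, so the function is the weighted Wronskian; the two products of first
  -- derivatives cancel on differentiation.
  obtain ⟨ξ, hξ, e⟩ := exists_hasDerivAt_eq_zero (by norm_num : (-1 : ℝ) < 1)
    (f := fun x ↦ φ x * Q x - Real.exp (2 * s * m x) * derivWithin φ unitIcc x * ψ x)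
    (f' := fun x ↦ Real.exp (2 * s * m x) * (φ x * (b x - (c x - l) * ψ x)))
    (by fun_prop) (by simp [hQ0, hQ1, h.neumann_left, h.neumann_right]) fun x hx ↦ by
      refine (((h.hasDerivAt hx).mul (hQ' x hx)).sub
        ((h.hasDerivAt_flux hm hx).mul (hψ' x hx))).congr_deriv ?_
      field_simp
      ring
  refine ⟨ξ, hξ, ?_⟩
  have h1 := hφ ξ (Ioo_subset_Icc_self hξ)
  simp only [mul_eq_zero, (Real.exp_pos _).ne', h1.ne', false_or] at e
  linarith

lemma eq_of_pos {k : ℝ} {ψ : ℝ → ℝ} (hm : ContDiffOn ℝ 1 m unitIcc)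
    (h : IsNeumannSolution m c s l φ) (hφ : ∀ x ∈ unitIcc, 0 < φ x)
    (h' : IsNeumannSolution m c s k ψ) (hψ : ∀ x ∈ unitIcc, 0 < ψ x) : l = k := by
  have hmc := hm.continuousOn
  have hdc := h'.contDiffOn_derivWithin.continuousOn
  obtain ⟨ξ, hξ, e⟩ := h.exists_eq_mul hm hφ h'.contDiffOn.continuousOn
    (Q := fun x ↦ Real.exp (2 * s * m x) * derivWithin ψ unitIcc x)
    (b := fun x ↦ (c x - k) * ψ x) (by fun_prop) (by simp [h'.neumann_left])
    (by simp [h'.neumann_right])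
    (fun x hx ↦ (h'.hasDerivAt hx).congr_deriv (by field_simp))
    (fun x hx ↦ h'.hasDerivAt_flux hm hx)
  have := mul_right_cancel₀ (hψ ξ (Ioo_subset_Icc_self hξ)).ne' e
  linarith

lemma abs_le (hm : ContDiffOn ℝ 1 m unitIcc) (h : IsNeumannSolution m c s l φ)
    (hφ : ∀ x ∈ unitIcc, 0 < φ x) {B : ℝ} (hB : ∀ x ∈ unitIcc, |c x| ≤ B) : |l| ≤ B := by
  -- Comparison with a constant shows that `l` is a value of `c`.
  obtain ⟨ξ, hξ, e⟩ := h.exists_eq_mul hm hφ (ψ := fun _ ↦ 1) (Q := fun _ ↦ 0) (b := fun _ ↦ 0)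
    continuousOn_const continuousOn_const rfl rfl
    (fun x _ ↦ (hasDerivAt_const x 1).congr_deriv (by simp))
    (fun x _ ↦ (hasDerivAt_const x 0).congr_deriv (by simp))
  have : l = c ξ := by linarith
  exact this ▸ hB ξ (Ioo_subset_Icc_self hξ)

end IsNeumannSolution

/-! ### Existence of the principal eigenvalue. -/

lemma exists_isPrincipalEigenvalue {m c : ℝ → ℝ} (hm : ContDiffOn ℝ 1 m unitIcc)
    (hc : ContinuousOn c unitIcc) (s : ℝ) : ∃ l, IsPrincipalEigenvalue m c s l := by
  obtain ⟨n, hn, hnm, A, hA⟩ := exists_bounded_continuous_extension hm.continuousOn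
  obtain ⟨d, hd, hdc, B, hB⟩ := exists_bounded_continuous_extension hc
  have hud : UniqueDiffOn ℝ unitIcc := uniqueDiffOn_Icc (by norm_num)
  have hb : ∀ x, |2 * s * n x| ≤ 2 * |s| * A := fun x ↦ by
    rw [abs_mul, abs_mul, abs_two]
    exact mul_le_mul_of_nonneg_left (hA x) (by positivity)
  obtain ⟨l, P, hP0, hP1, hP⟩ := exists_riccati_solution (W := fun x ↦ Real.exp (2 * s * n x))
    (c := d) (by fun_prop) hd (Real.exp_pos (-(2 * |s| * A)))
    (fun x ↦ Real.exp_le_exp.2 (_root_.abs_le.1 (hb x)).1)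
    (fun x ↦ Real.exp_le_exp.2 (_root_.abs_le.1 (hb x)).2) hB
  have hPc : ContinuousOn P unitIcc := fun x hx ↦ (hP x hx).continuousWithinAt
  -- `p` is to be the logarithmic derivative `φ' / φ`.
  set p : ℝ → ℝ := fun x ↦ P x / Real.exp (2 * s * m x) with hp
  have hmd : ∀ x ∈ unitIcc, HasDerivWithinAt m (derivWithin m unitIcc x) unitIcc x := fun x hx ↦
    (hm.differentiableOn (by norm_num) x hx).hasDerivWithinAt
  have hpd : ∀ x ∈ unitIcc, HasDerivWithinAt p
      (c x - l - p x ^ 2 - 2 * s * derivWithin m unitIcc x * p x) unitIcc x := fun x hx ↦ by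
    have h1 := hP x hx
    simp only [hnm hx, hdc hx] at h1
    refine (h1.div ((hmd x hx).const_mul (2 * s)).exp (Real.exp_pos _).ne').congr_deriv ?_
    simp only [hp]
    field_simp
  have hpc : ContinuousOn p unitIcc := fun x hx ↦ (hpd x hx).continuousWithinAt
  obtain ⟨q, hq, hqp, -⟩ := exists_bounded_continuous_extension hpc
  set φ : ℝ → ℝ := fun x ↦ Real.exp (∫ t in (0 : ℝ)..x, q t) with hφ
  have hφd : ∀ x, HasDerivAt φ (φ x * q x) x := fun x ↦
    (intervalIntegral.integral_hasDerivAt_right (hq.intervalIntegrable _ _)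
      (hq.stronglyMeasurableAtFilter _ _) hq.continuousAt).exp
  have hφ1 : ∀ x ∈ unitIcc, derivWithin φ unitIcc x = φ x * p x := fun x hx ↦ by
    rw [(hφd x).hasDerivWithinAt.derivWithin (hud x hx), hqp hx]
  have hφ2 : ∀ x ∈ unitIcc, HasDerivWithinAt (derivWithin φ unitIcc)
      (φ x * (c x - l - 2 * s * derivWithin m unitIcc x * p x)) unitIcc x := fun x hx ↦ by
    have h1 := ((hφd x).hasDerivWithinAt (s := unitIcc)).mul (hpd x hx)
    rw [hqp hx] at h1
    refine (h1.congr_of_mem hφ1 hx).congr_deriv (by ring)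
  have hφc : Continuous φ := continuous_iff_continuousAt.2 fun x ↦ (hφd x).continuousAt
  have hm'c : ContinuousOn (derivWithin m unitIcc) unitIcc :=
    hm.continuousOn_derivWithin hud (by norm_num)
  refine ⟨l, φ, ⟨?_, fun x hx ↦ ?_, ?_, ?_⟩, fun x _ ↦ Real.exp_pos _⟩
  · rw [show (2 : WithTop ℕ∞) = 1 + 1 by norm_num, contDiffOn_succ_iff_derivWithin hud]
    refine ⟨fun x _ ↦ (hφd x).differentiableAt.differentiableWithinAt, by simp, ?_⟩
    rw [show (1 : WithTop ℕ∞) = 0 + 1 by norm_num, contDiffOn_succ_iff_derivWithin hud]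
    refine ⟨fun x hx ↦ (hφ2 x hx).differentiableWithinAt, by simp, contDiffOn_zero.2 ?_⟩
    refine ContinuousOn.congr ?_ fun x hx ↦ (hφ2 x hx).derivWithin (hud x hx)
    fun_prop
  · rw [iteratedDerivWithin_succ', iteratedDerivWithin_one, (hφ2 x hx).derivWithin (hud x hx),
      hφ1 x hx]
    ring
  · rw [hφ1 _ (by norm_num)]; simp [hp, hP0]
  · rw [hφ1 _ (by norm_num)]; simp [hp, hP1]

/-! ### Concentration of the weight at `x₀`. -/

lemma tendsto_integral_exp_mul_of_neg {g : ℝ → ℝ} (hg : Continuous g) {a b : ℝ} (hab : a ≤ b)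
    (hneg : ∀ t ∈ Ioo a b, g t < 0) :
    Tendsto (fun s : ℝ ↦ ∫ t in a..b, Real.exp (2 * s * g t)) atTop (𝓝 0) := by
  have h : ∀ᵐ t : ℝ, t ∈ uIoc a b → g t < 0 := by
    -- `uIoc` contains `b`, where `g` may vanish; this point is discarded as a null set.
    have : ∀ᵐ t : ℝ, t ≠ b := by simp [MeasureTheory.ae_iff]
    filter_upwards [this] with t ht h
    rw [uIoc_of_le hab] at h
    exact hneg t ⟨h.1, h.2.lt_of_ne ht⟩
  have := intervalIntegral.tendsto_integral_filter_of_dominated_convergence (a := a) (b := b)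
    (μ := MeasureTheory.volume) (l := atTop) (F := fun s t ↦ Real.exp (2 * s * g t))
    (f := fun _ ↦ (0 : ℝ)) (fun _ ↦ (1 : ℝ))
    (.of_forall fun s ↦ (by fun_prop : Continuous _).aestronglyMeasurable)
    (by
      filter_upwards [eventually_ge_atTop 0] with s hs
      filter_upwards [h] with t ht hm
      rw [Real.norm_eq_abs, Real.abs_exp, Real.exp_le_one_iff]
      exact mul_nonpos_of_nonneg_of_nonpos (by positivity) (ht hm).le)
    (by simp)
    (by
      filter_upwards [h] with t ht hm
      refine Real.tendsto_exp_atBot.comp ?_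
      exact (tendsto_id.const_mul_atTop two_pos).atTop_mul_const_of_neg (ht hm))
  simpa using this

/-- The mean of `c` over `[-1,1]` with respect to the weight `exp (2 s m)`. -/
noncomputable def weightedMean (m c : ℝ → ℝ) (s : ℝ) : ℝ :=
  (∫ x in (-1 : ℝ)..1, Real.exp (2 * s * m x) * c x) / ∫ x in (-1 : ℝ)..1, Real.exp (2 * s * m x)

/-- The primitive, vanishing at `-1`, of `exp (2 s m) (c - weightedMean m c s)`. -/
noncomputable def weightedPrimitive (m c : ℝ → ℝ) (s y : ℝ) : ℝ :=
  ∫ x in (-1 : ℝ)..y, Real.exp (2 * s * m x) * (c x - weightedMean m c s)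

section

variable {m c : ℝ → ℝ} {x₀ B : ℝ}

lemma integral_exp_pos (hm : Continuous m) (s : ℝ) :
    0 < ∫ x in (-1 : ℝ)..1, Real.exp (2 * s * m x) :=
  intervalIntegral.intervalIntegral_pos_of_pos
    ((by fun_prop : Continuous _).intervalIntegrable _ _) (fun _ ↦ Real.exp_pos _) (by norm_num)

lemma abs_weightedMean_le (hm : Continuous m) (hc : Continuous c) (hB : ∀ x, |c x| ≤ B) (s : ℝ) :
    |weightedMean m c s| ≤ B := by
  have h := integral_exp_pos hm s
  rw [weightedMean, abs_div, abs_of_pos h, div_le_iff₀ h, ← intervalIntegral.integral_const_mul]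
  refine (intervalIntegral.abs_integral_le_integral_abs (by norm_num)).trans
    (intervalIntegral.integral_mono_on (by norm_num)
      ((by fun_prop : Continuous _).intervalIntegrable _ _)
      ((by fun_prop : Continuous _).intervalIntegrable _ _) fun x _ ↦ ?_)
  rw [abs_mul, Real.abs_exp, mul_comm]
  exact mul_le_mul_of_nonneg_right (hB x) (Real.exp_pos _).le

/-- Laplace's method: the normalised weights form an approximate identity at the strict maximum
point `x₀`. -/
lemma tendsto_weightedMean (hm : Continuous m) (hc : Continuous c) (hx₀ : x₀ ∈ Ioo (-1 : ℝ) 1)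
    (hmax : ∀ x ∈ Icc (-1 : ℝ) 1, x ≠ x₀ → m x < m x₀) :
    Tendsto (weightedMean m c) atTop (𝓝 (c x₀)) := by
  have hpos := integral_exp_pos hm
  have hnn : ∀ s x, 0 ≤ Real.exp (2 * s * m x) / ∫ x in (-1 : ℝ)..1, Real.exp (2 * s * m x) :=
    fun s x ↦ div_nonneg (Real.exp_pos _).le (hpos s).le
  have key := tendsto_setIntegral_peak_smul_of_integrableOn_of_tendsto (x₀ := x₀) (l := atTop)
    (φ := fun s x ↦ Real.exp (2 * s * m x) / ∫ x in (-1 : ℝ)..1, Real.exp (2 * s * m x))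
    (μ := MeasureTheory.volume) (g := c) (a := c x₀) (measurableSet_Ioc (a := (-1 : ℝ)) (b := 1))
    measurableSet_Ioc Subset.rfl self_mem_nhdsWithin (by simp) (.of_forall fun s x _ ↦ hnn s x)
    ?_ ?_ (.of_forall fun s ↦ (by fun_prop : Continuous _).aestronglyMeasurable)
    (hc.integrableOn_Ioc) hc.continuousWithinAt
  · refine key.congr fun s ↦ ?_
    rw [← intervalIntegral.integral_of_le (by norm_num), weightedMean, div_eq_inv_mul,
      ← intervalIntegral.integral_const_mul]
    congr 1 with x
    rw [smul_eq_mul]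
    ring
  · intro u hu hxu
    -- Off `u` the potential lies `2 κ` below its maximum, while within `δ` of `x₀` it lies less
    -- than `κ` below. The normalised weight off `u` is thus at most `exp (-2 s κ) / (2 δ)`.
    obtain ⟨κ, hκ, hle⟩ : ∃ κ > 0, ∀ x ∈ Icc (-1 : ℝ) 1 \ u, m x ≤ m x₀ - 2 * κ := by
      rcases (Icc (-1 : ℝ) 1 \ u).eq_empty_or_nonempty with he | hne
      · exact ⟨1, one_pos, by simp [he]⟩
      · obtain ⟨z, hz, hzm⟩ := (isCompact_Icc.diff hu).exists_isMaxOn hne hm.continuousOn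
        have := hmax z hz.1 fun e ↦ hz.2 (e ▸ hxu)
        exact ⟨(m x₀ - m z) / 2, by linarith, fun x hx ↦ by linarith [isMaxOn_iff.1 hzm x hx]⟩
    have hnear : {x | m x₀ - κ < m x} ∩ Ioo (-1) 1 ∈ 𝓝 x₀ :=
      inter_mem ((isOpen_lt continuous_const hm).mem_nhds (by simp [hκ])) (Ioo_mem_nhds hx₀.1 hx₀.2)
    obtain ⟨δ, hδ, hball⟩ := Metric.nhds_basis_closedBall.mem_iff.1 hnear
    rw [Real.closedBall_eq_Icc] at hball
    have hl := hball (left_mem_Icc.2 (by linarith : x₀ - δ ≤ x₀ + δ))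
    have hr := hball (right_mem_Icc.2 (by linarith : x₀ - δ ≤ x₀ + δ))
    have hlow : ∀ s, 0 ≤ s → 2 * δ * Real.exp (2 * s * (m x₀ - κ)) ≤
        ∫ x in (-1 : ℝ)..1, Real.exp (2 * s * m x) := fun s hs ↦ by
      calc 2 * δ * Real.exp (2 * s * (m x₀ - κ))
          = ∫ _ in (x₀ - δ)..(x₀ + δ), Real.exp (2 * s * (m x₀ - κ)) := by
            rw [intervalIntegral.integral_const, smul_eq_mul]; ring
        _ ≤ ∫ x in (x₀ - δ)..(x₀ + δ), Real.exp (2 * s * m x) := by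
            refine intervalIntegral.integral_mono_on (by linarith)
              (by simp) ((by fun_prop : Continuous _).intervalIntegrable _ _) fun x hx ↦ ?_
            have : m x₀ - κ < m x := (hball hx).1
            gcongr
        _ ≤ _ := intervalIntegral.integral_mono_interval hl.2.1.le (by linarith) hr.2.2.le
            (.of_forall fun x ↦ (Real.exp_pos _).le)
            ((by fun_prop : Continuous _).intervalIntegrable _ _)
    have hlim : Tendsto (fun s : ℝ ↦ Real.exp (2 * s * (-κ)) / (2 * δ)) atTop (𝓝 0) := by
      have : Tendsto (fun s : ℝ ↦ 2 * s * (-κ)) atTop atBot :=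
        (tendsto_id.const_mul_atTop two_pos).atTop_mul_const_of_neg (by linarith)
      simpa using (Real.tendsto_exp_atBot.comp this).div_const (2 * δ)
    rw [Metric.tendstoUniformlyOn_iff]
    intro ε hε
    filter_upwards [hlim.eventually (gt_mem_nhds hε), eventually_ge_atTop 0] with s h1 h2 x hx
    rw [Pi.zero_apply, dist_zero_left, Real.norm_eq_abs, abs_of_nonneg (hnn s x)]
    refine lt_of_le_of_lt ?_ h1
    rw [div_le_div_iff₀ (hpos s) (by positivity)]
    have h3 := hle x ⟨Ioc_subset_Icc_self hx.1, hx.2⟩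
    calc Real.exp (2 * s * m x) * (2 * δ)
        ≤ Real.exp (2 * s * (-κ) + 2 * s * (m x₀ - κ)) * (2 * δ) := by
          have : 2 * s * m x ≤ 2 * s * (m x₀ - 2 * κ) := by gcongr
          gcongr
          linarith
      _ = Real.exp (2 * s * (-κ)) * (2 * δ * Real.exp (2 * s * (m x₀ - κ))) := by
          rw [Real.exp_add]; ring
      _ ≤ _ := by gcongr; exact hlow s h2
  · refine tendsto_const_nhds.congr fun s ↦ ?_
    rw [← intervalIntegral.integral_of_le (by norm_num), intervalIntegral.integral_div,
      div_self (hpos s).ne']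

lemma weightedPrimitive_one (hm : Continuous m) (hc : Continuous c) (s : ℝ) :
    weightedPrimitive m c s 1 = 0 := by
  simp only [weightedPrimitive, mul_sub]
  rw [intervalIntegral.integral_sub ((by fun_prop : Continuous _).intervalIntegrable _ _)
    ((by fun_prop : Continuous _).intervalIntegrable _ _), intervalIntegral.integral_mul_const,
    weightedMean, mul_div_cancel₀ _ (integral_exp_pos hm s).ne', sub_self]

lemma hasDerivAt_weightedPrimitive (hm : Continuous m) (hc : Continuous c) (s x : ℝ) :
    HasDerivAt (weightedPrimitive m c s)
      (Real.exp (2 * s * m x) * (c x - weightedMean m c s)) x := by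
  have h : Continuous fun x ↦ Real.exp (2 * s * m x) * (c x - weightedMean m c s) := by fun_prop
  exact intervalIntegral.integral_hasDerivAt_right (h.intervalIntegrable _ _)
    (h.stronglyMeasurableAtFilter _ _) h.continuousAt

lemma continuous_weightedPrimitive (hm : Continuous m) (hc : Continuous c) (s : ℝ) :
    Continuous (weightedPrimitive m c s) :=
  continuous_iff_continuousAt.2 fun x ↦ (hasDerivAt_weightedPrimitive hm hc s x).continuousAt

lemma abs_integral_exp_mul_div_le (hm : Continuous m) (hc : Continuous c) (hB : ∀ x, |c x| ≤ B)
    (s y : ℝ) {a b : ℝ} (hab : a ≤ b) :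
    |(∫ x in a..b, Real.exp (2 * s * m x) * (c x - weightedMean m c s)) / Real.exp (2 * s * m y)| ≤
      2 * B * ∫ t in a..b, Real.exp (2 * s * (m t - m y)) := by
  rw [← intervalIntegral.integral_div, ← intervalIntegral.integral_const_mul]
  refine (intervalIntegral.abs_integral_le_integral_abs hab).trans
    (intervalIntegral.integral_mono_on hab
      (Continuous.intervalIntegrable (by fun_prop (disch := simp)) _ _)
      ((by fun_prop : Continuous _).intervalIntegrable _ _) fun x _ ↦ ?_)
  rw [mul_div_right_comm, ← Real.exp_sub, ← mul_sub, abs_mul, Real.abs_exp, mul_comm]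
  have : |c x - weightedMean m c s| ≤ 2 * B :=
    (abs_sub _ _).trans (by linarith [hB x, abs_weightedMean_le hm hc hB s])
  gcongr

lemma abs_weightedPrimitive_div_le_left (hm : Continuous m) (hc : Continuous c)
    (hB : ∀ x, |c x| ≤ B) (s : ℝ) {y : ℝ} (hy : -1 ≤ y) :
    |weightedPrimitive m c s y / Real.exp (2 * s * m y)| ≤
      2 * B * ∫ t in (-1 : ℝ)..y, Real.exp (2 * s * (m t - m y)) :=
  abs_integral_exp_mul_div_le hm hc hB s y hy

lemma abs_weightedPrimitive_div_le_right (hm : Continuous m) (hc : Continuous c)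
    (hB : ∀ x, |c x| ≤ B) (s : ℝ) {y : ℝ} (hy : y ≤ 1) :
    |weightedPrimitive m c s y / Real.exp (2 * s * m y)| ≤
      2 * B * ∫ t in y..1, Real.exp (2 * s * (m t - m y)) := by
  have h : weightedPrimitive m c s y =
      -∫ x in y..1, Real.exp (2 * s * m x) * (c x - weightedMean m c s) := by
    rw [eq_neg_iff_add_eq_zero, ← weightedPrimitive_one hm hc s, weightedPrimitive,
      intervalIntegral.integral_add_adjacent_intervals, weightedPrimitive]
    all_goals exact (by fun_prop : Continuous _).intervalIntegrable _ _
  rw [h, neg_div, abs_neg]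
  exact abs_integral_exp_mul_div_le hm hc hB s y hy

/-- The primitive vanishes at both endpoints, so it can be integrated from the endpoint on the same
side of `x₀` as `y`. There `m t < m y` for `t` strictly between, so the quotient tends to zero
pointwise and is bounded by `2 * B * 2`; dominated convergence in `y` concludes. -/
lemma tendsto_integral_abs_weightedPrimitive_div (hm : Continuous m) (hc : Continuous c)
    (hB : ∀ x, |c x| ≤ B)
    (hmono : StrictMonoOn m (Icc (-1) x₀)) (hanti : StrictAntiOn m (Icc x₀ 1)) :
    Tendsto (fun s ↦ ∫ y in (-1 : ℝ)..1, |weightedPrimitive m c s y / Real.exp (2 * s * m y)|)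
      atTop (𝓝 0) := by
  have hB0 : 0 ≤ B := (abs_nonneg _).trans (hB 0)
  have hle : ∀ {a b y s : ℝ}, 0 ≤ s → a ≤ b → b - a ≤ 2 → (∀ t ∈ Icc a b, m t ≤ m y) →
      2 * B * ∫ t in a..b, Real.exp (2 * s * (m t - m y)) ≤ 2 * B * 2 := by
    intro a b y s hs hab h2 h
    gcongr
    calc ∫ t in a..b, Real.exp (2 * s * (m t - m y)) ≤ ∫ _ in a..b, (1 : ℝ) :=
          intervalIntegral.integral_mono_on hab
            ((by fun_prop : Continuous _).intervalIntegrable _ _) (by simp) fun t ht ↦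
            Real.exp_le_one_iff.2
              (mul_nonpos_of_nonneg_of_nonpos (by positivity) (sub_nonpos.2 (h t ht)))
      _ ≤ 2 := by simpa using h2
  have key := intervalIntegral.tendsto_integral_filter_of_dominated_convergence
    (a := -1) (b := 1) (μ := MeasureTheory.volume) (l := atTop)
    (F := fun s y ↦ |weightedPrimitive m c s y / Real.exp (2 * s * m y)|)
    (f := fun _ ↦ (0 : ℝ)) (fun _ ↦ 2 * B * 2)
    (.of_forall fun s ↦ by
      have := continuous_weightedPrimitive hm hc s
      exact Continuous.aestronglyMeasurable (by fun_prop (disch := simp)))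
    (by
      filter_upwards [eventually_ge_atTop 0] with s hs
      refine .of_forall fun y hy ↦ ?_
      rw [uIoc_of_le (by norm_num)] at hy
      rw [Real.norm_eq_abs, abs_abs]
      rcases le_total y x₀ with h | h
      · exact (abs_weightedPrimitive_div_le_left hm hc hB s hy.1.le).trans
          (hle hs hy.1.le (by linarith [hy.2]) fun t ht ↦
            hmono.monotoneOn ⟨ht.1, ht.2.trans h⟩ ⟨hy.1.le, h⟩ ht.2)
      · exact (abs_weightedPrimitive_div_le_right hm hc hB s hy.2).trans
          (hle hs hy.2 (by linarith [hy.1]) fun t ht ↦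
            hanti.antitoneOn ⟨h, hy.2⟩ ⟨h.trans ht.1, ht.2⟩ ht.1))
    (by simp)
    (by
      refine .of_forall fun y hy ↦ ?_
      rw [uIoc_of_le (by norm_num)] at hy
      rcases le_total y x₀ with h | h
      · refine squeeze_zero (fun _ ↦ abs_nonneg _)
          (fun s ↦ abs_weightedPrimitive_div_le_left hm hc hB s hy.1.le) ?_
        simpa using (tendsto_integral_exp_mul_of_neg (hm.sub continuous_const) hy.1.le
          fun t ht ↦ sub_neg.2 (hmono ⟨ht.1.le, ht.2.le.trans h⟩ ⟨hy.1.le, h⟩ ht.2)).const_mul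
            (2 * B)
      · refine squeeze_zero (fun _ ↦ abs_nonneg _)
          (fun s ↦ abs_weightedPrimitive_div_le_right hm hc hB s hy.2) ?_
        simpa using (tendsto_integral_exp_mul_of_neg (hm.sub continuous_const) hy.2
          fun t ht ↦ sub_neg.2 (hanti ⟨h, hy.2⟩ ⟨h.trans ht.1.le, ht.2.le⟩ ht.1)).const_mul
            (2 * B))
  simpa using key

end

/-! ### Strict monotonicity of the potential on either side of `x₀`. -/

/-- A monotone function taking equal values at two points is constant between them, which would give
infinitely many critical points. -/
lemma strictMonoOn_of_deriv_nonneg_of_finite {f f' : ℝ → ℝ} {a b : ℝ}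
    (hf : ContinuousOn f (Icc a b)) (hf' : ∀ x ∈ Ioo a b, HasDerivAt f (f' x) x)
    (h0 : ∀ x ∈ Ioo a b, 0 ≤ f' x) (hfin : {x ∈ Ioo a b | f' x = 0}.Finite) :
    StrictMonoOn f (Icc a b) := by
  have hmono : MonotoneOn f (Icc a b) := by
    refine monotoneOn_of_deriv_nonneg (convex_Icc a b) hf ?_ ?_
    all_goals
      rw [interior_Icc]
      intro x hx
    · exact (hf' x hx).differentiableAt.differentiableWithinAt
    · exact (hf' x hx).deriv ▸ h0 x hx
  intro x hx y hy hxy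
  refine (hmono hx hy hxy.le).lt_of_ne fun e ↦ (Ioo_infinite hxy) (hfin.subset fun z hz ↦ ?_)
  have hsub : ∀ w ∈ Ioo x y, w ∈ Ioo a b := fun w hw ↦ ⟨hx.1.trans_lt hw.1, hw.2.trans_le hy.2⟩
  have hconst : f =ᶠ[𝓝 z] fun _ ↦ f x := by
    filter_upwards [Ioo_mem_nhds hz.1 hz.2] with w hw
    have hw' := Ioo_subset_Icc_self (hsub w hw)
    exact le_antisymm ((hmono hw' hy hw.2.le).trans e.ge) (hmono hx hw' hw.1.le)
  exact ⟨hsub z hz, (hf' z (hsub z hz)).unique ((hasDerivAt_const z (f x)).congr_of_eventuallyEq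
    hconst)⟩

namespace AdmissiblePotential

variable {m : ℝ → ℝ} {x₀ : ℝ}

lemma hasDerivAt (hm : AdmissiblePotential m x₀) {x : ℝ} (hx : x ∈ Ioo (-1 : ℝ) 1) :
    HasDerivAt m (derivWithin m unitIcc x) x :=
  hasDerivAt_of_derivWithin (hm.contDiffOn.differentiableOn (by norm_num)) hx

lemma strictMonoOn (hm : AdmissiblePotential m x₀) : StrictMonoOn m (Icc (-1) x₀) :=
  strictMonoOn_of_deriv_nonneg_of_finite
    (hm.contDiffOn.continuousOn.mono (Icc_subset_Icc_right hm.mem.2.le))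
    (fun _ hx ↦ hm.hasDerivAt ⟨hx.1, hx.2.trans hm.mem.2⟩)
    (fun x hx ↦ hm.deriv_nonneg x ⟨hx.1.le, hx.2⟩)
    (hm.finite_critical.subset fun _ hx ↦ ⟨⟨hx.1.1, hx.1.2.trans hm.mem.2⟩, hx.2⟩)

lemma strictAntiOn (hm : AdmissiblePotential m x₀) : StrictAntiOn m (Icc x₀ 1) := by
  have h := strictMonoOn_of_deriv_nonneg_of_finite (f := fun x ↦ -m x)
    (hm.contDiffOn.continuousOn.mono (Icc_subset_Icc_left hm.mem.1.le)).neg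
    (fun _ hx ↦ (hm.hasDerivAt ⟨hm.mem.1.trans hx.1, hx.2⟩).neg)
    (fun x hx ↦ neg_nonneg.2 (hm.deriv_nonpos x ⟨hx.1, hx.2.le⟩))
    (hm.finite_critical.subset fun _ hx ↦ ⟨⟨hm.mem.1.trans hx.1.1, hx.1.2⟩, neg_eq_zero.1 hx.2⟩)
  exact fun x hx y hy hxy ↦ neg_lt_neg_iff.1 (h hx hy hxy)

end AdmissiblePotential

/-! ### Distance from the eigenvalue to the weighted mean, and conclusion. -/

lemma abs_sub_weightedMean_le {m n c d φ : ℝ → ℝ} {s l B : ℝ} (hm : ContDiffOn ℝ 1 m unitIcc)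
    (hn : Continuous n) (hnm : EqOn n m unitIcc) (hd : Continuous d) (hdc : EqOn d c unitIcc)
    (hB : ∀ x, |d x| ≤ B) (h : IsNeumannSolution m c s l φ) (hφ : ∀ x ∈ unitIcc, 0 < φ x) :
    |l - weightedMean n d s| ≤
      2 * B * ∫ y in (-1 : ℝ)..1, |weightedPrimitive n d s y / Real.exp (2 * s * n y)| := by
  have hQ := continuous_weightedPrimitive hn hd s
  have hr : Continuous fun y ↦ weightedPrimitive n d s y / Real.exp (2 * s * n y) := by
    fun_prop (disch := simp)
  set r : ℝ → ℝ := fun y ↦ weightedPrimitive n d s y / Real.exp (2 * s * n y) with hr'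
  set η : ℝ → ℝ := fun x ↦ ∫ y in (-1 : ℝ)..x, r y with hη
  have hηd : ∀ x, HasDerivAt η (r x) x := fun x ↦
    intervalIntegral.integral_hasDerivAt_right (hr.intervalIntegrable _ _)
      (hr.stronglyMeasurableAtFilter _ _) hr.continuousAt
  have hηc : Continuous η := continuous_iff_continuousAt.2 fun x ↦ (hηd x).continuousAt
  -- `1 + η` is the corrected test function; no sign condition on it is needed.
  obtain ⟨ξ, hξ, e⟩ := h.exists_eq_mul hm hφ (ψ := fun x ↦ 1 + η x) (Q := weightedPrimitive n d s)
    (b := fun x ↦ d x - weightedMean n d s) (by fun_prop) hQ.continuousOn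
    (by simp [weightedPrimitive]) (weightedPrimitive_one hn hd s)
    (fun x hx ↦ ((hηd x).const_add 1).congr_deriv
      (by rw [← hnm (Ioo_subset_Icc_self hx)]))
    (fun x hx ↦ (hasDerivAt_weightedPrimitive hn hd s x).congr_deriv
      (by rw [← hnm (Ioo_subset_Icc_self hx)]))
  have hl : |l| ≤ B := h.abs_le hm hφ fun x hx ↦ hdc hx ▸ hB x
  rw [← hdc (Ioo_subset_Icc_self hξ)] at e
  have e' : l - weightedMean n d s = (d ξ - l) * η ξ := by linarith
  rw [e', abs_mul]
  have h1 : |d ξ - l| ≤ 2 * B := (abs_sub _ _).trans (by linarith [hB ξ])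
  have h2 : |η ξ| ≤ ∫ y in (-1 : ℝ)..1, |r y| :=
    (intervalIntegral.abs_integral_le_integral_abs hξ.1.le).trans
      (intervalIntegral.integral_mono_interval le_rfl hξ.1.le hξ.2.le
        (.of_forall fun _ ↦ abs_nonneg _) (hr.abs.intervalIntegrable _ _))
  exact mul_le_mul h1 h2 (abs_nonneg _) ((abs_nonneg _).trans h1)

/-- For every real `s` the principal eigenvalue `lam s` exists and is unique, and
`lam s → c x₀` as `s → ∞`. -/
theorem theorem1p2 (m c : ℝ → ℝ) (x₀ : ℝ) (hm : AdmissiblePotential m x₀)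
    (hc : ContinuousOn c (Icc (-1) 1)) (hc' : MonotoneOrUnimodal c) :
    ∃ lam : ℝ → ℝ,
      (∀ s l : ℝ, IsPrincipalEigenvalue m c s l ↔ l = lam s) ∧
      Tendsto lam atTop (𝓝 (c x₀)) := by
  choose lam hlam using exists_isPrincipalEigenvalue hm.contDiffOn hc
  refine ⟨lam, fun s l ↦ ⟨?_, fun h ↦ h ▸ hlam s⟩, ?_⟩
  · rintro ⟨φ, hφ, hpos⟩
    obtain ⟨ψ, hψ, hψpos⟩ := hlam s
    exact hφ.eq_of_pos hm.contDiffOn hpos hψ hψpos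
  obtain ⟨n, hn, hnm, -⟩ := exists_bounded_continuous_extension hm.contDiffOn.continuousOn
  obtain ⟨d, hd, hdc, B, hB⟩ := exists_bounded_continuous_extension hc
  have hx₀ : x₀ ∈ unitIcc := Ioo_subset_Icc_self hm.mem
  have hmono : StrictMonoOn n (Icc (-1) x₀) :=
    hm.strictMonoOn.congr (hnm.mono (Icc_subset_Icc_right hx₀.2)).symm
  have hanti : StrictAntiOn n (Icc x₀ 1) :=
    hm.strictAntiOn.congr (hnm.mono (Icc_subset_Icc_left hx₀.1)).symm
  have hmean := tendsto_weightedMean hn hd hm.mem fun x hx hne ↦ by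
    rcases hne.lt_or_gt with h | h
    · exact hmono ⟨hx.1, h.le⟩ ⟨hx₀.1, le_rfl⟩ h
    · exact hanti ⟨le_rfl, hx₀.2⟩ ⟨h.le, hx.2⟩ h
  have hdiff : Tendsto (fun s ↦ lam s - weightedMean n d s) atTop (𝓝 0) := by
    refine squeeze_zero_norm (fun s ↦ ?_) (by
      simpa using (tendsto_integral_abs_weightedPrimitive_div hn hd hB hmono hanti).const_mul
        (2 * B))
    obtain ⟨φ, hφ, hpos⟩ := hlam s
    exact abs_sub_weightedMean_le hm.contDiffOn hn hnm hd hdc hB hφ hpos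
  simpa [hdc hx₀] using hdiff.add hmean
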